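/- Let $\mathcal X\subseteq\mathbb R^d$ be a data space with the metric induced by the max norm $\|\cdot\|$, let $P$ be a probability distribution on $\mathcal X$, let $h$ be a fixed model, and let $x\mapsto f(h,x)$ be a nonnegative, bounded, measurable loss on $\mathcal X$ with $C=\sup_{x\in\mathcal X} f(h,x)$. Let $\boldsymbol D=(s_1,\dots,s_m)$, $m\ge 1$, be i.i.d. samples from $P$, and let $\mathcal X=\bigcup_{i=1}^N\mathcal X_i$ be a partition into $N$ disjoint nonempty measurable subsets. Let $\boldsymbol D_i$ be the family of samples that fall into $\mathcal X_i$ (counted with multiplicity), $m_i=|\boldsymbol D_i|$, and $\boldsymbol T=\{i\in[N]: m_i>0\}$. For $i\in\boldsymbol T$ put $$\lambda_i=\frac1{m_i}\sum_{s\in \boldsymbol D_i}\mathbb E_{x\sim P}\big[\|x-s\| \,\big|\, x\in\mathcal X_i\big]\in[0,\infty].$$ Put $F(P,h)=\mathbb E_{x\sim P}[f(h,x)]$ and $F(\boldsymbol D,h)=\frac1m\sum_{j=1}^m f(h,s_j)$, and for $\delta>0$ $$g(\boldsymbol D,\delta)=C(\sqrt2+1)\sqrt{\frac{|\boldsymbol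 T|\ln(2N/\delta)}{m}}+\frac{2C|\boldsymbol T|\ln(2N/\delta)}{m}.$$ Then for every $\delta>0$, with probability at least $1-\delta$ over $\boldsymbol D$ the following holds: for all $L_1,\dots,L_N\ge 0$ such that $f(h,\cdot)$ is $L_i$-Lipschitz continuous on $\mathcal X_i$ for every $i\in\boldsymbol T$, $$F(P,h)\le F(\boldsymbol D,h)+\sum_{i\in\boldsymbol T}\frac{m_i}{m}\lambda_iL_i+g(\boldsymbol D,\delta),$$ with the convention $\infty\cdot 0=0$. -/

import Mathlib

open MeasureTheory ProbabilityTheory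
open scoped ENNReal NNReal

namespace LocalLipschitz

/-- The sets `A i`, `i ∈ [N]`, form a (measurable) partition of the data space `𝒳`
into `N` disjoint nonempty subsets. -/
structure IsCellPartition {d N : ℕ} {𝒳 : Set (Fin d → ℝ)} (A : Fin N → Set 𝒳) : Prop where
  measurableSet : ∀ i, MeasurableSet (A i)
  nonempty : ∀ i, (A i).Nonempty
  disjoint : Pairwise fun i j => Disjoint (A i) (A j)
  iUnion_eq : ⋃ i, A i = Set.univ

section

variable {d m N : ℕ} {𝒳 : Set (Fin d → ℝ)} {H : Type*}

/-- Expected loss `F(P, h) = E_{x ∼ P} f(h, x)`. -/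
noncomputable def expectedLoss (P : Measure 𝒳) (f : H → 𝒳 → ℝ) (h : H) : ℝ :=
  ∫ x, f h x ∂P

/-- Empirical loss `F(D, h) = (1/m) ∑_{s ∈ D} f(h, s)`. -/
noncomputable def empiricalLoss (D : Fin m → 𝒳) (f : H → 𝒳 → ℝ) (h : H) : ℝ :=
  (1 / (m : ℝ)) * ∑ j, f h (D j)

open Classical in
/-- The indices of the samples of `D` that fall into the cell `A i`
(so that samples are counted with multiplicity). -/
noncomputable def samplesIn (A : Fin N → Set 𝒳) (D : Fin m → 𝒳) (i : Fin N) : Finset (Fin m) :=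
  Finset.univ.filter fun j => D j ∈ A i

/-- `m_i`, the number of samples that fall into the cell `A i`. -/
noncomputable def cellCount (A : Fin N → Set 𝒳) (D : Fin m → 𝒳) (i : Fin N) : ℕ :=
  (samplesIn A D i).card

/-- `T = {i ∈ [N] : m_i > 0}`. -/
noncomputable def occupied (A : Fin N → Set 𝒳) (D : Fin m → 𝒳) : Finset (Fin N) :=
  Finset.univ.filter fun i => 0 < cellCount A D i

/-- `λ_i = (1/m_i) ∑_{s ∈ D_i} E_{x ∼ P}[‖x - s‖ : x ∈ A i]`, where `‖·‖` is the max norm and the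
expectation is conditional on the cell. It takes values in `[0, ∞]`, so that no moment assumption
on `P` is needed. -/
noncomputable def avgDist (P : Measure 𝒳) (A : Fin N → Set 𝒳) (D : Fin m → 𝒳) (i : Fin N) :
    ℝ≥0∞ :=
  (cellCount A D i : ℝ≥0∞)⁻¹ *
    ∑ j ∈ samplesIn A D i, ∫⁻ x, ‖(x : Fin d → ℝ) - (D j : Fin d → ℝ)‖ₑ ∂(P[|A i])

/-- `C = sup_x f(h, x)`. -/
noncomputable def supLoss (f : H → 𝒳 → ℝ) (h : H) : ℝ :=
  ⨆ x, f h x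

/-- `g(D, δ) = C (√2 + 1) √(|T| ln(2N/δ) / m) + 2 C |T| ln(2N/δ) / m`. -/
noncomputable def gTerm (f : H → 𝒳 → ℝ) (h : H) (A : Fin N → Set 𝒳) (D : Fin m → 𝒳) (δ : ℝ) :
    ℝ :=
  supLoss f h * (√2 + 1) * √(((occupied A D).card : ℝ) * Real.log (2 * N / δ) / m) +
    2 * supLoss f h * ((occupied A D).card : ℝ) * Real.log (2 * N / δ) / m

end

end LocalLipschitz

/-!
On a cell where the loss is `L`-Lipschitz, its conditional mean is at most its value at any sample
`s` in the cell plus `L` times the mean distance to `s`. Averaged over the samples, this bounds the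
mean loss by the empirical loss plus the Lipschitz term, provided that the cells are weighted by
their empirical frequencies `c i`. Since the deficit `C - loss` is nonnegative, passing to the true
probabilities `p i` costs at most `C` times the sum of `(c i - p i)⁺` over the occupied cells, and
the unoccupied cells can only help. Chernoff's bound gives `√(c i) ≤ √(p i) + √ε`, hence
`c i - p i ≤ 2 √ε √(p i) + ε`, for all cells at once; by Cauchy–Schwarz the sum of these errors over
the occupied cells is bounded in terms of their number and `ε` alone.
-/

namespace LocalLipschitz

section Concentration

variable {Ω : Type*} [MeasurableSpace Ω] {μ : Measure Ω}

lemma mgf_le_exp_of_mem_Icc_zero_one [IsProbabilityMeasure μ] {Y : Ω → ℝ}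
    (hY : AEMeasurable Y μ) (hY01 : ∀ᵐ ω ∂μ, Y ω ∈ Set.Icc 0 1) (t : ℝ) :
    mgf Y μ t ≤ Real.exp (μ[Y] * (Real.exp t - 1)) := by
  have hY_int : Integrable Y μ := .of_mem_Icc 0 1 hY hY01
  have hchord : ∀ᵐ ω ∂μ, Real.exp (t * Y ω) ≤ 1 + Y ω * (Real.exp t - 1) := by
    filter_upwards [hY01] with ω ⟨h0, h1⟩
    have hconv := convexOn_exp.2 (Set.mem_univ 0) (Set.mem_univ t) (sub_nonneg.2 h1) h0
      (sub_add_cancel 1 (Y ω))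
    simp only [smul_eq_mul, mul_zero, zero_add, Real.exp_zero, mul_one] at hconv
    rw [mul_comm t]
    linarith
  calc mgf Y μ t ≤ ∫ ω, 1 + Y ω * (Real.exp t - 1) ∂μ :=
        integral_mono_ae (integrable_exp_mul_of_mem_Icc hY hY01)
          ((integrable_const 1).add (hY_int.mul_const _)) hchord
    _ = μ[Y] * (Real.exp t - 1) + 1 := by
        rw [integral_add (integrable_const 1) (hY_int.mul_const _), integral_mul_const]
        simp [add_comm]
    _ ≤ Real.exp (μ[Y] * (Real.exp t - 1)) := Real.add_one_le_exp _

lemma exists_neg_mul_add_mul_exp_sub_one_le {q l : ℝ} (hq : 0 ≤ q) (hl : 0 ≤ l) :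
    ∃ t : ℝ, 0 ≤ t ∧ -t * (√q + √l) ^ 2 + q * (Real.exp t - 1) ≤ -l := by
  rcases hq.eq_or_lt with rfl | hq
  · exact ⟨1, zero_le_one, by simp [Real.sq_sqrt hl]⟩
  have hu : 0 < √q := Real.sqrt_pos.2 hq
  -- Bounding `exp t` by `1 / (1 - t)` makes the exponent at this `t` exactly `-l`.
  refine ⟨√l / (√q + √l), by positivity, ?_⟩
  have hexp : Real.exp (√l / (√q + √l)) ≤ (√q + √l) / √q := by
    refine (Real.exp_bound_div_one_sub_of_interval (by positivity)
      ((div_lt_one (by positivity)).2 (by linarith))).trans_eq ?_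
    rw [one_sub_div (by positivity), add_sub_cancel_right, one_div_div]
  calc -(√l / (√q + √l)) * (√q + √l) ^ 2 + q * (Real.exp (√l / (√q + √l)) - 1)
      ≤ -(√l / (√q + √l)) * (√q + √l) ^ 2 + √q ^ 2 * ((√q + √l) / √q - 1) := by
        rw [Real.sq_sqrt hq.le]; gcongr
    _ = -√l ^ 2 := by field_simp; ring
    _ = -l := by rw [Real.sq_sqrt hl]

lemma measureReal_sq_sqrt_add_sqrt_le_sum_le {κ : Type*} {Y : κ → Ω → ℝ}
    (hY : ∀ j, AEMeasurable (Y j) μ) (hY_indep : iIndepFun Y μ)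
    (hY01 : ∀ j, ∀ᵐ ω ∂μ, Y j ω ∈ Set.Icc 0 1) (s : Finset κ) {l : ℝ} (hl : 0 ≤ l) :
    μ.real {ω | (√(∑ j ∈ s, μ[Y j]) + √l) ^ 2 ≤ ∑ j ∈ s, Y j ω} ≤ Real.exp (-l) := by
  have := hY_indep.isProbabilityMeasure
  have hmean : 0 ≤ ∑ j ∈ s, μ[Y j] := Finset.sum_nonneg fun j _ =>
    integral_nonneg_of_ae ((hY01 j).mono fun _ h => h.1)
  obtain ⟨t, ht, hle⟩ := exists_neg_mul_add_mul_exp_sub_one_le hmean hl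
  have hmgf : mgf (∑ j ∈ s, Y j) μ t ≤ Real.exp ((∑ j ∈ s, μ[Y j]) * (Real.exp t - 1)) := by
    rw [hY_indep.mgf_sum₀ hY, Finset.sum_mul, Real.exp_sum]
    exact Finset.prod_le_prod (fun _ _ => mgf_nonneg) fun j _ =>
      mgf_le_exp_of_mem_Icc_zero_one (hY j) (hY01 j) t
  have hsum : ∀ᵐ ω ∂μ, (∑ j ∈ s, Y j) ω ∈ Set.Icc 0 (∑ _j ∈ s, (1 : ℝ)) := by
    filter_upwards [(Filter.eventually_all_finset s).2 fun j _ => hY01 j] with ω hω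
    rw [Finset.sum_apply]
    exact ⟨Finset.sum_nonneg fun j hj => (hω j hj).1, Finset.sum_le_sum fun j hj => (hω j hj).2⟩
  have hint : Integrable (fun ω => Real.exp (t * (∑ j ∈ s, Y j) ω)) μ :=
    integrable_exp_mul_of_mem_Icc (Finset.aemeasurable_sum s fun j _ => hY j) hsum
  simp only [← Finset.sum_apply]
  calc μ.real {ω | (√(∑ j ∈ s, μ[Y j]) + √l) ^ 2 ≤ (∑ j ∈ s, Y j) ω}
      ≤ Real.exp (-t * (√(∑ j ∈ s, μ[Y j]) + √l) ^ 2) * mgf (∑ j ∈ s, Y j) μ t :=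
        measure_ge_le_exp_mul_mgf _ ht hint
    _ ≤ Real.exp (-t * (√(∑ j ∈ s, μ[Y j]) + √l) ^ 2) *
          Real.exp ((∑ j ∈ s, μ[Y j]) * (Real.exp t - 1)) := by gcongr
    _ ≤ Real.exp (-l) := by rw [← Real.exp_add]; exact Real.exp_le_exp.2 hle

end Concentration

section EmpiricalFrequency

variable {ι κ : Type*} [DecidableEq ι] [Fintype κ]

/-- The empirical frequency of the label `i` in the finite family of labels `y`
(equal to `0` for the empty family). -/
noncomputable def labelFreq (y : κ → ι) (i : ι) : ℝ :=
  (Finset.univ.filter fun j => y j = i).card / Fintype.card κ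

lemma sum_labelFreq_mul (y : κ → ι) (a : ι → ℝ) :
    ∑ i ∈ Finset.univ.image y, labelFreq y i * a i = (∑ j, a (y j)) / Fintype.card κ := by
  rw [Finset.sum_comp a y, Finset.sum_div]
  refine Finset.sum_congr rfl fun i _ => ?_
  rw [labelFreq, nsmul_eq_mul, div_mul_eq_mul_div]

lemma sum_labelFreq [Nonempty κ] (y : κ → ι) : ∑ i ∈ Finset.univ.image y, labelFreq y i = 1 := by
  simpa using sum_labelFreq_mul y fun _ => 1

variable {Ω : Type*} [MeasurableSpace Ω] {μ : Measure Ω} [MeasurableSpace ι]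
  [MeasurableSingletonClass ι] {Q : Measure ι} {y : κ → Ω → ι}

lemma measureReal_sqrt_add_sqrt_lt_sqrt_labelFreq_le (hy_law : ∀ j, HasLaw (y j) Q μ)
    (hy_indep : iIndepFun y μ) (i : ι) {l : ℝ} (hl : 0 ≤ l) :
    μ.real {ω | √(Q.real {i}) + √(l / Fintype.card κ) < √(labelFreq (fun j => y j ω) i)} ≤
      Real.exp (-l) := by
  have := hy_indep.isProbabilityMeasure
  set Y : ι → ℝ := ({i} : Set ι).indicator 1
  have hY : Measurable Y := measurable_one.indicator (measurableSet_singleton i)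
  have hY01 (k : ι) : Y k ∈ Set.Icc 0 1 :=
    ⟨Set.indicator_nonneg (fun _ _ => zero_le_one) k,
      Set.indicator_le_self' (fun _ _ => zero_le_one) k⟩
  have hmean (j : κ) : μ[Y ∘ y j] = Q.real {i} := by
    rw [(hy_law j).integral_comp hY.aestronglyMeasurable,
      integral_indicator_one (measurableSet_singleton i)]
  have htail := measureReal_sq_sqrt_add_sqrt_le_sum_le (Y := fun j => Y ∘ y j)
    (fun j => hY.comp_aemeasurable (hy_law j).aemeasurable) (hy_indep.comp _ fun _ => hY)
    (fun j => ae_of_all _ fun ω => hY01 _) Finset.univ hl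
  simp only [hmean, Finset.sum_const, Finset.card_univ, nsmul_eq_mul] at htail
  refine (measureReal_mono fun ω hω => ?_).trans htail
  have : Nonempty κ := by
    by_contra hκ
    rw [not_nonempty_iff] at hκ
    have hω' : √(Q.real {i}) < 0 := by simpa [labelFreq] using hω
    exact hω'.not_ge (Real.sqrt_nonneg _)
  have hcount : ∑ j, (Y ∘ y j) ω = Fintype.card κ * labelFreq (fun j => y j ω) i := by
    simp only [Function.comp_apply, Y, Set.indicator_apply, Set.mem_singleton_iff, Pi.one_apply,
      Finset.sum_boole, labelFreq]
    rw [mul_div_cancel₀ _ (by positivity)]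
  have hscale : √(Fintype.card κ * Q.real {i}) + √l =
      √(Fintype.card κ) * (√(Q.real {i}) + √(l / Fintype.card κ)) := by
    rw [mul_add, ← Real.sqrt_mul (Nat.cast_nonneg _), ← Real.sqrt_mul (Nat.cast_nonneg _),
      mul_div_cancel₀ _ (by positivity)]
  have hfreq := (Real.lt_sqrt (by positivity)).1 hω
  change _ ≤ ∑ j, (Y ∘ y j) ω
  rw [hcount, hscale, mul_pow, Real.sq_sqrt (Nat.cast_nonneg _)]
  gcongr

lemma one_sub_card_mul_exp_le_measure_forall_sqrt_labelFreq_le [Fintype ι]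
    (hy_law : ∀ j, HasLaw (y j) Q μ) (hy_indep : iIndepFun y μ) {l : ℝ} (hl : 0 ≤ l) :
    ENNReal.ofReal (1 - Fintype.card ι * Real.exp (-l)) ≤
      μ {ω | ∀ i, √(labelFreq (fun j => y j ω) i) ≤
        √(Q.real {i}) + √(l / Fintype.card κ)} := by
  have := hy_indep.isProbabilityMeasure
  set good : Set Ω := {ω | ∀ i, √(labelFreq (fun j => y j ω) i) ≤
    √(Q.real {i}) + √(l / Fintype.card κ)}
  have hbad : μ.real goodᶜ ≤ Fintype.card ι * Real.exp (-l) := by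
    calc μ.real goodᶜ
        = μ.real (⋃ i, {ω | √(Q.real {i}) + √(l / Fintype.card κ) <
            √(labelFreq (fun j => y j ω) i)}) := by
          congr 1; ext ω; simp [good]
      _ ≤ ∑ i, μ.real {ω | √(Q.real {i}) + √(l / Fintype.card κ) <
            √(labelFreq (fun j => y j ω) i)} := measureReal_iUnion_fintype_le _
      _ ≤ ∑ _i : ι, Real.exp (-l) := Finset.sum_le_sum fun i _ =>
          measureReal_sqrt_add_sqrt_lt_sqrt_labelFreq_le hy_law hy_indep i hl
      _ = Fintype.card ι * Real.exp (-l) := by simp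
  have hcover : 1 ≤ μ.real good + μ.real goodᶜ := by
    simpa using measureReal_union_le (μ := μ) good goodᶜ
  exact ENNReal.ofReal_le_of_le_toReal (by rw [← measureReal_def]; linarith)

end EmpiricalFrequency

section ConvexCombination

variable {ι : Type*} [Fintype ι] {T : Finset ι} {p c a e : ι → ℝ} {C : ℝ}

lemma sum_mul_le_sum_mul_add_of_le_add (hp : ∀ i, 0 ≤ p i) (hp1 : ∑ i, p i = 1)
    (hc1 : ∑ i ∈ T, c i = 1) (ha : ∀ i, a i ∈ Set.Icc 0 C) (he : ∀ i ∈ T, 0 ≤ e i)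
    (hcp : ∀ i ∈ T, c i ≤ p i + e i) :
    ∑ i, p i * a i ≤ ∑ i ∈ T, c i * a i + C * ∑ i ∈ T, e i := by
  have hb (i : ι) : 0 ≤ C - a i := sub_nonneg.2 (ha i).2
  have hp_def : ∑ i, p i * a i = C - ∑ i, p i * (C - a i) := by
    simp only [mul_sub, Finset.sum_sub_distrib, ← Finset.sum_mul, hp1]
    ring
  have hc_def : ∑ i ∈ T, c i * a i = C - ∑ i ∈ T, c i * (C - a i) := by
    simp only [mul_sub, Finset.sum_sub_distrib, ← Finset.sum_mul, hc1]
    ring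
  have hdeficit : ∑ i ∈ T, c i * (C - a i) ≤ ∑ i, p i * (C - a i) + C * ∑ i ∈ T, e i := by
    calc ∑ i ∈ T, c i * (C - a i) ≤ ∑ i ∈ T, (p i * (C - a i) + C * e i) := by
          refine Finset.sum_le_sum fun i hi => ?_
          have hce := mul_le_mul_of_nonneg_right (hcp i hi) (hb i)
          have hea := mul_nonneg (he i hi) (ha i).1
          linarith
      _ = ∑ i ∈ T, p i * (C - a i) + C * ∑ i ∈ T, e i := by
          rw [Finset.sum_add_distrib, Finset.mul_sum]
      _ ≤ ∑ i, p i * (C - a i) + C * ∑ i ∈ T, e i := by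
          have := Finset.sum_le_univ_sum_of_nonneg (s := T) fun i => mul_nonneg (hp i) (hb i)
          gcongr ?_ + _
  linarith

lemma sum_sqrt_le_sqrt_card (hp : ∀ i, 0 ≤ p i) (hp1 : ∑ i, p i = 1) :
    ∑ i ∈ T, √(p i) ≤ √(T.card : ℝ) := by
  calc ∑ i ∈ T, √(p i) = ∑ i ∈ T, √1 * √(p i) := by simp
    _ ≤ √(∑ _i ∈ T, 1) * √(∑ i ∈ T, p i) :=
        Real.sum_sqrt_mul_sqrt_le T (fun _ => zero_le_one) hp
    _ ≤ √(∑ _i ∈ T, 1) * √1 := by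
        gcongr
        exact (Finset.sum_le_univ_sum_of_nonneg hp).trans_eq hp1
    _ = √(T.card : ℝ) := by simp

lemma sum_mul_le_sum_mul_add_of_sqrt_le {ε : ℝ} (hε : 0 ≤ ε) (hp : ∀ i, 0 ≤ p i)
    (hp1 : ∑ i, p i = 1) (hc1 : ∑ i ∈ T, c i = 1) (ha : ∀ i, a i ∈ Set.Icc 0 C)
    (hcp : ∀ i ∈ T, √(c i) ≤ √(p i) + √ε) (hC : 0 ≤ C) :
    ∑ i, p i * a i ≤ ∑ i ∈ T, c i * a i + C * (2 * √(T.card * ε) + T.card * ε) := by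
  have hexcess (i) (hi : i ∈ T) : c i ≤ p i + (2 * √ε * √(p i) + ε) := by
    calc c i ≤ (√(p i) + √ε) ^ 2 := (Real.sqrt_le_left (by positivity)).1 (hcp i hi)
      _ = √(p i) ^ 2 + (2 * √ε * √(p i) + √ε ^ 2) := by ring
      _ = p i + (2 * √ε * √(p i) + ε) := by rw [Real.sq_sqrt (hp i), Real.sq_sqrt hε]
  calc ∑ i, p i * a i
      ≤ ∑ i ∈ T, c i * a i + C * ∑ i ∈ T, (2 * √ε * √(p i) + ε) :=
        sum_mul_le_sum_mul_add_of_le_add hp hp1 hc1 ha (fun i _ => by positivity) hexcess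
    _ = ∑ i ∈ T, c i * a i + C * (2 * √ε * ∑ i ∈ T, √(p i) + T.card * ε) := by
        rw [Finset.sum_add_distrib, ← Finset.mul_sum, Finset.sum_const, nsmul_eq_mul]
    _ ≤ ∑ i ∈ T, c i * a i + C * (2 * √ε * √(T.card : ℝ) + T.card * ε) := by
        gcongr
        exact sum_sqrt_le_sqrt_card hp hp1
    _ = ∑ i ∈ T, c i * a i + C * (2 * √(T.card * ε) + T.card * ε) := by
        rw [Real.sqrt_mul (Nat.cast_nonneg _)]
        ring

end ConvexCombination

section TotalExpectation

variable {X ι κ : Type*} [MeasurableSpace X] [MeasurableSpace ι] [MeasurableSingletonClass ι]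
  {P : Measure X} {π : X → ι}

lemma integral_eq_sum_measureReal_smul_integral_cond {E : Type*} [NormedAddCommGroup E]
    [NormedSpace ℝ E] [Fintype ι] [IsFiniteMeasure P] (hπ : Measurable π) {φ : X → E}
    (hφ : Integrable φ P) :
    ∫ x, φ x ∂P = ∑ i, P.real (π ⁻¹' {i}) • ∫ x, φ x ∂P[|π ⁻¹' {i}] := by
  have hP := sum_meas_smul_cond_fiber hπ P
  have hφ_cell : ∀ i ∈ Finset.univ, Integrable φ (P (π ⁻¹' {i}) • P[|π ⁻¹' {i}]) :=
    integrable_finsetSum_measure.1 (hP.symm ▸ hφ)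
  conv_lhs => rw [← hP]
  simp only [integral_finsetSum_measure hφ_cell, integral_smul_measure, measureReal_def]

lemma integral_le_of_sqrt_labelFreq_le [Finite ι] [DecidableEq ι] [Fintype κ] [Nonempty κ]
    [IsProbabilityMeasure P] (hπ : Measurable π) {φ : X → ℝ}
    (hφ_meas : AEStronglyMeasurable φ P) {C : ℝ} (hφ : ∀ x, φ x ∈ Set.Icc 0 C) (s : κ → X)
    {ε : ℝ} (hε : 0 ≤ ε)
    (hfreq : ∀ i, √(labelFreq (π ∘ s) i) ≤ √(P.real (π ⁻¹' {i})) + √ε) :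
    ∫ x, φ x ∂P ≤ (∑ j, ∫ x, φ x ∂P[|π ⁻¹' {π (s j)}]) / Fintype.card κ +
      C * (2 * √((Finset.univ.image (π ∘ s)).card * ε) +
        (Finset.univ.image (π ∘ s)).card * ε) := by
  cases nonempty_fintype ι
  obtain ⟨x₀⟩ := nonempty_of_isProbabilityMeasure P
  have hC : 0 ≤ C := (hφ x₀).1.trans (hφ x₀).2
  have hφ_norm (x : X) : ‖φ x‖ ≤ C := by
    rw [Real.norm_of_nonneg (hφ x).1]; exact (hφ x).2
  have hcond (i : ι) : ∫ x, φ x ∂P[|π ⁻¹' {i}] ∈ Set.Icc 0 C := by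
    refine ⟨integral_nonneg fun x => (hφ x).1, (le_abs_self _).trans ?_⟩
    exact (norm_integral_le_of_norm_le_const (ae_of_all _ hφ_norm)).trans
      (mul_le_of_le_one_right hC measureReal_le_one)
  have hp1 : ∑ i, P.real (π ⁻¹' {i}) = 1 := by
    simpa using sum_measureReal_preimage_singleton (μ := P) Finset.univ
      fun i _ => hπ (measurableSet_singleton i)
  have haverage := sum_labelFreq_mul (π ∘ s) fun i => ∫ x, φ x ∂P[|π ⁻¹' {i}]
  simp only [Function.comp_apply] at haverage
  have hφ_int : Integrable φ P := .of_bound hφ_meas C (ae_of_all _ hφ_norm)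
  rw [integral_eq_sum_measureReal_smul_integral_cond hπ hφ_int, ← haverage]
  exact sum_mul_le_sum_mul_add_of_sqrt_le hε (fun _ => measureReal_nonneg) hp1
    (sum_labelFreq _) hcond (fun i _ => hfreq i) hC

end TotalExpectation

section LipschitzOnCells

variable {X : Type*} [PseudoEMetricSpace X] [MeasurableSpace X]

lemma enorm_integral_le_of_lipschitzOnWith {E : Type*} [NormedAddCommGroup E] [NormedSpace ℝ E]
    {ν : Measure X} [IsZeroOrProbabilityMeasure ν] {φ : X → E} {B : Set X} (hB : ∀ᵐ x ∂ν, x ∈ B)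
    {L : ℝ≥0} (hL : LipschitzOnWith L φ B) {s : X} (hs : s ∈ B) :
    ‖∫ x, φ x ∂ν‖ₑ ≤ ‖φ s‖ₑ + L * ∫⁻ x, edist x s ∂ν := by
  have hpointwise : ∀ᵐ x ∂ν, ‖φ x‖ₑ ≤ ‖φ s‖ₑ + L * edist x s := by
    filter_upwards [hB] with x hx
    calc ‖φ x‖ₑ = ‖φ s + (φ x - φ s)‖ₑ := by rw [add_sub_cancel]
      _ ≤ ‖φ s‖ₑ + edist (φ x) (φ s) := by rw [edist_eq_enorm_sub]; exact enorm_add_le _ _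
      _ ≤ ‖φ s‖ₑ + L * edist x s := by gcongr; exact hL hx hs
  calc ‖∫ x, φ x ∂ν‖ₑ ≤ ∫⁻ x, ‖φ x‖ₑ ∂ν := enorm_integral_le_lintegral_enorm _
    _ ≤ ∫⁻ x, ‖φ s‖ₑ + L * edist x s ∂ν := lintegral_mono_ae hpointwise
    _ = ‖φ s‖ₑ * ν Set.univ + L * ∫⁻ x, edist x s ∂ν := by
        rw [lintegral_add_left measurable_const, lintegral_const,
          lintegral_const_mul' _ _ ENNReal.coe_ne_top]
    _ ≤ ‖φ s‖ₑ + L * ∫⁻ x, edist x s ∂ν := by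
        gcongr
        exact mul_le_of_le_one_right' prob_le_one

variable {ι κ : Type*} [Fintype κ]

/-- Mean distance from `s` to a random point of its own cell, for the partition of the space
into the level sets of the labelling map `π`. A sample average of it over a cell gives `λ_i`. -/
noncomputable def meanCellDist (P : Measure X) (π : X → ι) (s : X) : ℝ≥0∞ :=
  ∫⁻ x, edist x s ∂P[|π ⁻¹' {π s}]

variable [MeasurableSpace ι] [MeasurableSingletonClass ι] {P : Measure X} {π : X → ι} {φ : X → ℝ}

lemma average_integral_cond_le_average_add [Nonempty κ] (hπ : Measurable π)
    (hφ : ∀ x, 0 ≤ φ x) (s : κ → X) {L : ι → ℝ≥0}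
    (hL : ∀ j, LipschitzOnWith (L (π (s j))) φ (π ⁻¹' {π (s j)})) :
    (((∑ j, ∫ x, φ x ∂P[|π ⁻¹' {π (s j)}]) / Fintype.card κ : ℝ) : EReal) ≤
      (((∑ j, φ (s j)) / Fintype.card κ : ℝ) : EReal) +
        (((∑ j, L (π (s j)) * meanCellDist P π (s j)) / Fintype.card κ : ℝ≥0∞) : EReal) := by
  have hcond (j : κ) : ENNReal.ofReal (∫ x, φ x ∂P[|π ⁻¹' {π (s j)}]) ≤
      ENNReal.ofReal (φ (s j)) + L (π (s j)) * meanCellDist P π (s j) := by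
    rw [← Real.enorm_of_nonneg (hφ _), ← Real.enorm_of_nonneg (integral_nonneg hφ)]
    exact enorm_integral_le_of_lipschitzOnWith
      (ae_cond_mem (hπ (measurableSet_singleton (π (s j))))) (hL j) rfl
  have hm : (0 : ℝ) < Fintype.card κ := by positivity
  have hφ_avg : 0 ≤ (∑ j, φ (s j)) / Fintype.card κ :=
    div_nonneg (Finset.sum_nonneg fun j _ => hφ _) hm.le
  have hsum : ENNReal.ofReal ((∑ j, ∫ x, φ x ∂P[|π ⁻¹' {π (s j)}]) / Fintype.card κ) ≤
      ENNReal.ofReal ((∑ j, φ (s j)) / Fintype.card κ) +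
        (∑ j, L (π (s j)) * meanCellDist P π (s j)) / Fintype.card κ := by
    rw [ENNReal.ofReal_div_of_pos hm, ENNReal.ofReal_div_of_pos hm, ENNReal.ofReal_natCast,
      ENNReal.ofReal_sum_of_nonneg fun j _ => integral_nonneg hφ,
      ENNReal.ofReal_sum_of_nonneg fun j _ => hφ _, ← ENNReal.add_div, ← Finset.sum_add_distrib]
    gcongr with j
    exact hcond j
  calc (((∑ j, ∫ x, φ x ∂P[|π ⁻¹' {π (s j)}]) / Fintype.card κ : ℝ) : EReal)
      ≤ (ENNReal.ofReal ((∑ j, ∫ x, φ x ∂P[|π ⁻¹' {π (s j)}]) / Fintype.card κ) : EReal) := by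
        rw [EReal.coe_ennreal_ofReal]
        exact_mod_cast le_max_left _ _
    _ ≤ ((ENNReal.ofReal ((∑ j, φ (s j)) / Fintype.card κ) +
          (∑ j, L (π (s j)) * meanCellDist P π (s j)) / Fintype.card κ : ℝ≥0∞) : EReal) := by
        exact_mod_cast hsum
    _ = _ := by rw [EReal.coe_ennreal_add, EReal.coe_ennreal_ofReal, max_eq_left hφ_avg]

end LipschitzOnCells

section CellPartition

variable {d m N : ℕ} {𝒳 : Set (Fin d → ℝ)}

lemma IsCellPartition.exists_measurable_label {A : Fin N → Set 𝒳} (hA : IsCellPartition A) :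
    ∃ π : 𝒳 → Fin N, Measurable π ∧ (fun i => π ⁻¹' {i}) = A := by
  have hcover (x : 𝒳) : ∃ i, x ∈ A i := Set.mem_iUnion.1 (hA.iUnion_eq ▸ Set.mem_univ x)
  choose π hπ using hcover
  have hfiber (i : Fin N) : π ⁻¹' {i} = A i := by
    ext x
    refine ⟨fun hx => hx ▸ hπ x, fun hx => ?_⟩
    by_contra hne
    exact Set.disjoint_left.1 (hA.disjoint hne) (hπ x) hx
  exact ⟨π, measurable_to_countable' fun i => hfiber i ▸ hA.measurableSet i, funext hfiber⟩

lemma occupied_fiber (π : 𝒳 → Fin N) (D : Fin m → 𝒳) :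
    occupied (fun i => π ⁻¹' {i}) D = Finset.univ.image fun j => π (D j) := by
  ext i
  simp [occupied, cellCount, samplesIn, Finset.card_pos, Finset.filter_nonempty_iff]

lemma cellCount_mul_avgDist_fiber (P : Measure 𝒳) (π : 𝒳 → Fin N) (D : Fin m → 𝒳) (i : Fin N) :
    cellCount (fun i => π ⁻¹' {i}) D i * avgDist P (fun i => π ⁻¹' {i}) D i =
      ∑ j with π (D j) = i, meanCellDist P π (D j) := by
  rcases Nat.eq_zero_or_pos (cellCount (fun i => π ⁻¹' {i}) D i) with h0 | h0
  · have hempty : ({j | π (D j) = i} : Finset (Fin m)) = ∅ := by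
      simpa [cellCount, samplesIn, Finset.filter_eq_empty_iff] using h0
    rw [h0, hempty, Nat.cast_zero, zero_mul, Finset.sum_empty]
  rw [avgDist, ENNReal.mul_inv_cancel_left (by exact_mod_cast h0.ne') (ENNReal.natCast_ne_top _)]
  refine Finset.sum_congr (by ext j; simp [samplesIn]) fun j hj => ?_
  have hj' : π (D j) = i := by simpa [samplesIn] using hj
  simp only [meanCellDist, hj', Subtype.edist_eq, edist_eq_enorm_sub]

lemma sum_occupied_fiber_mul_avgDist_mul (P : Measure 𝒳) (π : 𝒳 → Fin N) (D : Fin m → 𝒳)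
    (L : Fin N → ℝ≥0) :
    ∑ i ∈ occupied (fun i => π ⁻¹' {i}) D, (cellCount (fun i => π ⁻¹' {i}) D i : ℝ≥0∞) / m *
        avgDist P (fun i => π ⁻¹' {i}) D i * L i =
      (∑ j, L (π (D j)) * meanCellDist P π (D j)) / m := by
  have hcell (i : Fin N) : (cellCount (fun i => π ⁻¹' {i}) D i : ℝ≥0∞) / m *
      avgDist P (fun i => π ⁻¹' {i}) D i * L i =
        (∑ j with π (D j) = i, L (π (D j)) * meanCellDist P π (D j)) / m := by
    rw [← ENNReal.mul_div_right_comm, ← ENNReal.mul_div_right_comm,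
      cellCount_mul_avgDist_fiber, mul_comm, Finset.mul_sum]
    congr 1
    refine Finset.sum_congr rfl fun j hj => ?_
    rw [(Finset.mem_filter.1 hj).2]
  simp_rw [hcell, occupied_fiber, div_eq_mul_inv]
  rw [← Finset.sum_mul, Finset.sum_fiberwise_of_maps_to fun j hj => Finset.mem_image_of_mem _ hj]

lemma supLoss_mul_le_gTerm {H : Type*} {f : H → 𝒳 → ℝ} {h : H} (hf : ∀ x, 0 ≤ f h x)
    (A : Fin N → Set 𝒳) (D : Fin m → 𝒳) {δ : ℝ} (hl : 0 ≤ Real.log (2 * N / δ)) :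
    supLoss f h * (2 * √((occupied A D).card * (Real.log (2 * N / δ) / m)) +
      (occupied A D).card * (Real.log (2 * N / δ) / m)) ≤ gTerm f h A D δ := by
  set C := supLoss f h
  set T : ℝ := ((occupied A D).card : ℝ)
  set l := Real.log (2 * N / δ)
  have hC : 0 ≤ C := Real.iSup_nonneg hf
  have hsqrt : 2 ≤ √2 + 1 := by
    have := Real.one_le_sqrt.2 one_le_two
    linarith
  have hT : 0 ≤ T * (l / m) := by positivity
  calc C * (2 * √(T * (l / m)) + T * (l / m))
      ≤ C * ((√2 + 1) * √(T * (l / m)) + 2 * (T * (l / m))) := by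
        gcongr _ * (?_ * _ + ?_)
        linarith
    _ = C * (√2 + 1) * √(T * l / m) + 2 * C * T * l / m := by rw [← mul_div_assoc]; ring

end CellPartition

end LocalLipschitz

theorem mainTheorem6_general {X : Type*} [PseudoEMetricSpace X] [MeasurableSpace X]
    (P : Measure X) [IsProbabilityMeasure P] (φ : X → ℝ) (hφ_meas : AEStronglyMeasurable φ P)
    (C : ℝ) (hφ : ∀ x, φ x ∈ Set.Icc 0 C)
    {ι : Type*} [Fintype ι] [DecidableEq ι] [MeasurableSpace ι] [MeasurableSingletonClass ι]
    (π : X → ι) (hπ : Measurable π)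
    {Ω : Type*} [MeasurableSpace Ω] (μ : Measure Ω) {κ : Type*} [Fintype κ] [Nonempty κ]
    (D : κ → Ω → X) (hD_indep : iIndepFun D μ) (hD_law : ∀ j, HasLaw (D j) P μ)
    (δ : ℝ) (hδ : 0 < δ) :
    ENNReal.ofReal (1 - δ) ≤
      μ {ω | ∀ L : ι → ℝ≥0,
        (∀ j, LipschitzOnWith (L (π (D j ω))) φ (π ⁻¹' {π (D j ω)})) →
        ((∫ x, φ x ∂P : ℝ) : EReal) ≤
          (((∑ j, φ (D j ω)) / Fintype.card κ : ℝ) : EReal) +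
          (((∑ j, L (π (D j ω)) * LocalLipschitz.meanCellDist P π (D j ω)) /
            Fintype.card κ : ℝ≥0∞) : EReal) +
          ((C * (2 * √((Finset.univ.image fun j => π (D j ω)).card *
              (Real.log (Fintype.card ι / δ) / Fintype.card κ)) +
            (Finset.univ.image fun j => π (D j ω)).card *
              (Real.log (Fintype.card ι / δ) / Fintype.card κ)) : ℝ) : EReal)} := by
  rcases le_or_gt 1 δ with hδ1 | hδ1
  · simp [ENNReal.ofReal_of_nonpos (sub_nonpos.2 hδ1)]
  have : Nonempty ι := (nonempty_of_isProbabilityMeasure P).map π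
  have hN : (1 : ℝ) ≤ Fintype.card ι := by exact_mod_cast Fintype.card_pos
  have hl : 0 ≤ Real.log (Fintype.card ι / δ) :=
    Real.log_nonneg ((one_le_div hδ).2 (hδ1.le.trans hN))
  have hπ_law : HasLaw π (P.map π) P := ⟨hπ.aemeasurable, rfl⟩
  have hconc := LocalLipschitz.one_sub_card_mul_exp_le_measure_forall_sqrt_labelFreq_le
    (fun j => hπ_law.comp (hD_law j)) (hD_indep.comp _ fun _ => hπ) hl
  rw [Real.exp_neg, Real.exp_log (by positivity), inv_div, mul_div_cancel₀ _ (by positivity)]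
    at hconc
  refine hconc.trans (measure_mono fun ω hω L hL => ?_)
  have hdev := LocalLipschitz.integral_le_of_sqrt_labelFreq_le hπ hφ_meas hφ (fun j => D j ω)
    (div_nonneg hl (Nat.cast_nonneg (Fintype.card κ))) fun i => by
      rw [← map_measureReal_apply hπ (measurableSet_singleton i)]
      exact hω i
  have hlip := LocalLipschitz.average_integral_cond_le_average_add (P := P) hπ
    (fun x => (hφ x).1) (fun j => D j ω) hL
  exact (EReal.coe_le_coe_iff.2 hdev).trans
    ((EReal.coe_add _ _).trans_le (add_le_add_left hlip _))

theorem mainTheorem6 {d m N : ℕ} (hm : 0 < m)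
    -- the data space, the data distribution, the loss and the model
    (𝒳 : Set (Fin d → ℝ)) (P : Measure 𝒳) [IsProbabilityMeasure P]
    {H : Type*} (f : H → 𝒳 → ℝ) (h : H)
    (hf_meas : Measurable (f h)) (hf_nonneg : ∀ x, 0 ≤ f h x)
    (hf_bdd : BddAbove (Set.range (f h)))
    -- the partition of the data space
    (A : Fin N → Set 𝒳) (hA : LocalLipschitz.IsCellPartition A)
    -- the dataset: `m` i.i.d. samples from `P`
    {Ω : Type*} [MeasurableSpace Ω] (μ : Measure Ω) [IsProbabilityMeasure μ]
    (D : Fin m → Ω → 𝒳) (hD_meas : ∀ j, Measurable (D j))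
    (hD_indep : iIndepFun D μ) (hD_law : ∀ j, μ.map (D j) = P)
    (δ : ℝ) (hδ : 0 < δ) :
    ENNReal.ofReal (1 - δ) ≤
      μ {ω | ∀ L : Fin N → ℝ≥0,
        (∀ i ∈ LocalLipschitz.occupied A (fun j => D j ω), LipschitzOnWith (L i) (f h) (A i)) →
        (LocalLipschitz.expectedLoss P f h : EReal) ≤
          (LocalLipschitz.empiricalLoss (fun j => D j ω) f h : EReal) +
          ((∑ i ∈ LocalLipschitz.occupied A (fun j => D j ω),
              (LocalLipschitz.cellCount A (fun j => D j ω) i : ℝ≥0∞) / (m : ℝ≥0∞) *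
                LocalLipschitz.avgDist P A (fun j => D j ω) i * (L i : ℝ≥0∞) : ℝ≥0∞) : EReal) +
          (LocalLipschitz.gTerm f h A (fun j => D j ω) δ : EReal)} := by
  rcases le_or_gt 1 δ with hδ1 | hδ1
  · simp [ENNReal.ofReal_of_nonpos (sub_nonpos.2 hδ1)]
  obtain ⟨π, hπ, rfl⟩ := hA.exists_measurable_label
  have : Nonempty (Fin m) := Fin.pos_iff_nonempty.1 hm
  have hgeneral := mainTheorem6_general P (f h) hf_meas.aestronglyMeasurable
    (LocalLipschitz.supLoss f h) (fun x => ⟨hf_nonneg x, le_ciSup hf_bdd x⟩) π hπ μ D hD_indep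
    (fun j => ⟨(hD_meas j).aemeasurable, hD_law j⟩) (δ / 2) (half_pos hδ)
  refine (ENNReal.ofReal_le_ofReal (by linarith)).trans
    (hgeneral.trans (measure_mono fun ω hω L hL => ?_))
  have hN : (1 : ℝ) ≤ N := by exact_mod_cast (π (nonempty_of_isProbabilityMeasure P).some).pos
  have hl : 0 ≤ Real.log (2 * N / δ) := Real.log_nonneg ((one_le_div hδ).2 (by linarith))
  have hbound := hω L fun j => hL (π (D j ω)) (by simp [LocalLipschitz.occupied_fiber])
  rw [← LocalLipschitz.occupied_fiber π fun j => D j ω, Fintype.card_fin, Fintype.card_fin,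
    ← LocalLipschitz.sum_occupied_fiber_mul_avgDist_mul, div_div_eq_mul_div, mul_comm (N : ℝ) 2,
    ← one_div_mul_eq_div] at hbound
  exact hbound.trans (add_le_add_right (EReal.coe_le_coe_iff.2
    (LocalLipschitz.supLoss_mul_le_gTerm hf_nonneg _ _ hl)) _)
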